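/- Let $s$ and $n$ be positive integers, let $R$ be a commutative ring, and let $A=(a_{ij})$ be an $(s+n-1)\times sn$ matrix with entries in $R$ (for instance the generic matrix, whose entries $a_{ij}$ are independent indeterminates over $\mathbb{Q}$). For $I\subseteq\{1,\dots,s+n-1\}$ and $J\subseteq\{1,\dots,sn\}$ of equal size, let $A^I_J$ be the submatrix of $A$ with rows in $I$ and columns in $J$, both listed increasingly, and write $A_J$ for $A^I_J$ when $I=\{1,\dots,s+n-1\}$ consists of all rows. For a sequence $\mu=(\mu_1,\dots,\mu_s)$ of integers with $0\le\mu_k\le n$ put $$\iota(\mu)=\bigsqcup_{k=1}^{s}\{(k-1)n+1,\,(k-1)n+2,\,\dots,\,(k-1)n+\mu_k\}\subseteq\{1,\dots,sn\}.$$ Let $Z_{s,n}$ be the set of $\mu\in\mathbb{Z}_{\ge0}^s$ with $\mu_1+\dots+\mu_s=n$, and let $Z^0_{s,s+n-1}$ be the set of $\nu\in\mathbb{Z}_{>0}^s$ with $\nu_1+\dots+\nu_s=s+n-1$ (so that $\nu_k\le n$ for all $k$). Consider the square matrix $$\mathcal{M}(A)=\left(\det A^I_{\iota(\mu)}\right)_{I,\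 \mu}$$ of size $\binom{s+n-1}{n}$, whose rows are indexed by the $n$-element subsets $I$ of $\{1,\dots,s+n-1\}$, arranged in increasing lexicographic order of their increasing sequences of elements, and whose columns are indexed by $\mu\in Z_{s,n}$, arranged in decreasing lexicographic order, that is, from $(n,0,\dots,0)$ to $(0,\dots,0,n)$ (equivalently, so that the sets $\iota(\mu)$ increase lexicographically). Then $$\det\mathcal{M}(A)=\prod_{\nu\in Z^0_{s,s+n-1}}\det A_{\iota(\nu)}.$$ -/

import Mathlib

namespace CompoundMinor

/-- The set of `n`-element subsets of `{1, …, N}`, modelled as `Fin N`. -/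
def NSubset (N n : ℕ) : Type := {I : Finset (Fin N) // I.card = n}

/-- The element `i₁ < ⋯ < iₙ` of an `n`-subset, as an increasing map. -/
def NSubset.emb {N n : ℕ} (I : NSubset N n) : Fin n ↪o Fin N :=
  Finset.orderEmbOfFin I.1 I.2

theorem NSubset.toLex_emb_injective {N n : ℕ} :
    Function.Injective (fun I : NSubset N n => toLex (fun p => I.emb p)) := by
  intro I J h
  apply Subtype.ext
  have h' : (⇑I.emb : Fin n → Fin N) = ⇑J.emb := toLex.injective h
  have hI := Finset.range_orderEmbOfFin I.1 I.2
  have hJ := Finset.range_orderEmbOfFin J.1 J.2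
  apply Finset.coe_injective
  rw [← hI, ← hJ]
  exact congrArg Set.range h'

instance (N n : ℕ) : Fintype (NSubset N n) :=
  inferInstanceAs (Fintype {I : Finset (Fin N) // I.card = n})

/-- Lexicographic order on `n`-subsets: compare the increasing sequences of elements. -/
noncomputable instance (N n : ℕ) : LinearOrder (NSubset N n) :=
  LinearOrder.lift' (fun I => toLex (fun p => I.emb p)) NSubset.toLex_emb_injective

theorem NSubset.card_eq (N n : ℕ) : Fintype.card (NSubset N n) = N.choose n := by
  have h := Fintype.card_finset_len (α := Fin N) n
  rw [Fintype.card_fin] at h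
  exact h

/-- Compositions `μ = (μ₁, …, μₛ)` of `n` into `s` nonnegative parts. -/
def WeakComp (s n : ℕ) : Type := {μ : Fin s → ℕ // ∑ i, μ i = n}

instance (s n : ℕ) : Fintype (WeakComp s n) :=
  Fintype.subtype (Finset.piAntidiag Finset.univ n) (by simp)

/-- The order on compositions that is decreasing for the lexicographic order:
`lam < μ` when, at the first index `i` with `lamᵢ ≠ μᵢ`, one has `lamᵢ > μᵢ`
(so `(n, 0, …, 0)` is the first element and `(0, …, 0, n)` the last one). -/
noncomputable instance (s n : ℕ) : LinearOrder (WeakComp s n) :=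
  LinearOrder.lift' (fun μ => OrderDual.toDual (toLex μ.1))
    (fun _ _ h => Subtype.ext (toLex.injective (OrderDual.toDual.injective h)))

theorem WeakComp.card_eq (s n : ℕ) :
    Fintype.card (WeakComp s n) = (s + n - 1).choose n := by
  have h := Sym.card_sym_eq_choose (α := Fin s) n
  rw [Fintype.card_fin] at h
  rw [← h]
  exact Fintype.card_congr (Sym.equivNatSumOfFintype (Fin s) n).symm

/-- Compositions `ν = (ν₁, …, νₛ)` of `m` into `s` positive parts. -/
def PosComp (s m : ℕ) : Type := {ν : Fin s → ℕ // ∑ i, ν i = m ∧ ∀ i, 0 < ν i}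

instance (s m : ℕ) : Fintype (PosComp s m) :=
  Fintype.subtype
    ((Finset.piAntidiag Finset.univ m).filter (fun ν : Fin s → ℕ => ∀ i, 0 < ν i)) (by simp)

/-- `ι(μ)`: split the `s * n` columns into `s` consecutive blocks of length `n`, and take the
first `μₖ` columns of the `k`-th block. (Indices start from `0`.) -/
def iota {s : ℕ} (n : ℕ) (μ : Fin s → ℕ) : Finset (Fin (s * n)) :=
  Finset.univ.filter (fun j => ∃ k : Fin s, k.1 * n ≤ j.1 ∧ j.1 < k.1 * n + μ k)

theorem card_iota {s n : ℕ} (μ : Fin s → ℕ) (hμ : ∀ k, μ k ≤ n) :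
    (iota n μ).card = ∑ k, μ k := by
  have key : (iota n μ).card = (Finset.univ : Finset (Σ k : Fin s, Fin (μ k))).card := by
    symm
    refine Finset.card_bij
      (fun x _ => finProdFinEquiv (x.1, ⟨x.2.1, lt_of_lt_of_le x.2.2 (hμ x.1)⟩)) ?_ ?_ ?_
    · rintro ⟨k, i⟩ -
      simp only [iota, Finset.mem_filter, Finset.mem_univ, true_and]
      refine ⟨k, ?_, ?_⟩
      · simp [finProdFinEquiv, mul_comm]
      · have := i.2
        simp only [finProdFinEquiv, Equiv.coe_fn_mk]
        nlinarith
    · rintro ⟨k, i⟩ - ⟨l, j⟩ - h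
      have h' := finProdFinEquiv.injective h
      simp only [Prod.mk.injEq, Fin.mk.injEq] at h'
      obtain ⟨rfl, h2⟩ := h'
      have : i = j := Fin.ext h2
      rw [this]
    · intro j hj
      simp only [iota, Finset.mem_filter, Finset.mem_univ, true_and] at hj
      obtain ⟨k, h1, h2⟩ := hj
      refine ⟨⟨k, ⟨j.1 - k.1 * n, by omega⟩⟩, Finset.mem_univ _, ?_⟩
      apply Fin.ext
      simp only [finProdFinEquiv, Equiv.coe_fn_mk]
      rw [mul_comm n]
      omega
  rw [key, Finset.card_univ, Fintype.card_sigma]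
  simp

/-- `ι(μ)` as an `n`-subset of the columns, for `μ` a composition of `n`. -/
def WeakComp.iota {s n : ℕ} (μ : WeakComp s n) : NSubset (s * n) n :=
  ⟨CompoundMinor.iota n μ.1, by
    rw [card_iota _ fun k => ?_, μ.2]
    calc μ.1 k ≤ ∑ i, μ.1 i := Finset.single_le_sum (fun _ _ => Nat.zero_le _) (Finset.mem_univ k)
      _ = n := μ.2⟩

theorem PosComp.le {s n : ℕ} (ν : PosComp s (s + n - 1)) (k : Fin s) : ν.1 k ≤ n := by
  have h1 : ν.1 k + ∑ i ∈ Finset.univ.erase k, ν.1 i = s + n - 1 := by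
    rw [Finset.add_sum_erase _ _ (Finset.mem_univ k), ν.2.1]
  have h2 : (Finset.univ.erase k).card • 1 ≤ ∑ i ∈ Finset.univ.erase k, ν.1 i :=
    Finset.card_nsmul_le_sum _ _ _ (fun i _ => ν.2.2 i)
  rw [Finset.card_erase_of_mem (Finset.mem_univ k), Finset.card_univ, Fintype.card_fin] at h2
  have := k.2
  simp only [smul_eq_mul, mul_one] at h2
  omega

/-- `ι(ν)` as an `(s+n-1)`-subset of the columns, for `ν` a composition of `s+n-1` into
`s` positive parts. -/
def PosComp.iota {s n : ℕ} (ν : PosComp s (s + n - 1)) : NSubset (s * n) (s + n - 1) :=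
  ⟨CompoundMinor.iota n ν.1, by rw [card_iota _ ν.le, ν.2.1]⟩

/-- The `r × r` minor `det A^I_J`: rows in `I`, columns in `J`, both listed increasingly. -/
noncomputable def minor {R : Type*} [CommRing R] {a b r : ℕ} (A : Matrix (Fin a) (Fin b) R)
    (I : NSubset a r) (J : NSubset b r) : R :=
  (A.submatrix I.emb J.emb).det

/-- The maximal minor `det A_J`: all rows, columns in `J` listed increasingly. -/
noncomputable def maxMinor {R : Type*} [CommRing R] {a b : ℕ} (A : Matrix (Fin a) (Fin b) R)
    (J : NSubset b a) : R :=
  (A.submatrix id J.emb).det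

/-- The `n`-subsets of `[s+n-1]` listed in increasing lexicographic order. -/
noncomputable def rowEnum (s n : ℕ) :
    Fin ((s + n - 1).choose n) ≃o NSubset (s + n - 1) n :=
  Fintype.orderIsoFinOfCardEq _ (NSubset.card_eq _ _)

/-- The compositions of `n` into `s` nonnegative parts, listed from `(n, 0, …, 0)`
to `(0, …, 0, n)`. -/
noncomputable def colEnum (s n : ℕ) :
    Fin ((s + n - 1).choose n) ≃o WeakComp s n :=
  Fintype.orderIsoFinOfCardEq _ (WeakComp.card_eq _ _)

/-- The square matrix `(det A^I_{ι(μ)})` of size `binom(s+n-1, n)`, with rows `I` and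
columns `μ` in the orders above. -/
noncomputable def minorMatrix {R : Type*} [CommRing R] (s n : ℕ)
    (A : Matrix (Fin (s + n - 1)) (Fin (s * n)) R) :
    Matrix (Fin ((s + n - 1).choose n)) (Fin ((s + n - 1).choose n)) R :=
  Matrix.of fun p q => minor A (rowEnum s n p) (colEnum s n q).iota

end CompoundMinor

namespace CompoundMinor

/-! Replace the blocks of columns of `A` by `s` arbitrary sequences `v k` of vectors in `R^N` with
`s + n = N + 1`; the identity is then proved for all such families over all commutative rings
(`compoundIdentity`), by induction on `N`. Suppose the first vector `v 0 0` is the basis vector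
`e₀`. Split compositions by whether the first part is positive, and `n`-subsets by whether they
contain the first element. Both splittings are initial segments of equal size, and a minor with `e₀`
among its columns but without row `0` vanishes, so the matrix is block triangular. Deleting `e₀` and
row `0` turns the diagonal blocks into the same matrices for `(s, n - 1)` and `(s - 1, n)` in
dimension `N - 1`. On the right side the two factors are the `ν` with first part at least `2` and
those with first part `1` (`compoundIdentity_of_head_eq_single`). A general `v 0 0` with unit first
entry is reached by multiplying all vectors by a matrix `g`. By Cauchy–Binet the left side is
multiplied by the determinant of the `n`-th compound of `g`, and the right side by one `det g` per
`ν`. For `g = firstColMatrix x` both are the same power of `x 0`. Finally the first entry is made a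
unit by adding an indeterminate to it and localizing; setting the indeterminate to `0` gives the
identity in general (`compoundIdentity_succ`). -/

theorem NSubset.range_emb {N n : ℕ} (I : NSubset N n) : Set.range I.emb = I.1 :=
  Finset.range_orderEmbOfFin I.1 I.2

/-- The `n`-subset that is the range of a strictly increasing sequence. -/
def NSubset.ofStrictMono {N n : ℕ} (f : Fin n → Fin N) (hf : StrictMono f) : NSubset N n :=
  ⟨Finset.univ.map ⟨f, hf.injective⟩, by simp⟩

theorem NSubset.emb_ofStrictMono {N n : ℕ} (f : Fin n → Fin N) (hf : StrictMono f) :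
    ⇑(NSubset.ofStrictMono f hf).emb = f :=
  (Finset.orderEmbOfFin_unique _ (by simp [NSubset.ofStrictMono]) hf).symm

/-! ### Cauchy–Binet. -/

theorem exists_eq_emb_comp_perm {N r : ℕ} (f : Fin r → Fin N) (hf : Function.Injective f) :
    ∃ (K : NSubset N r) (σ : Equiv.Perm (Fin r)), K.emb ∘ σ = f := by
  let K : NSubset N r := ⟨Finset.univ.map ⟨f, hf⟩, by simp⟩
  have h : ∀ p, ∃ q, K.emb q = f p := by
    intro p
    have : f p ∈ Set.range K.emb := by
      rw [K.range_emb]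
      simp [K]
    exact this
  choose σ hσ using h
  have hinj : Function.Injective σ := fun p q hpq => hf (by rw [← hσ, ← hσ, hpq])
  exact ⟨K, Equiv.ofBijective σ (Finite.injective_iff_bijective.mp hinj), funext hσ⟩

theorem emb_comp_perm_injective {N r : ℕ} :
    Function.Injective (fun x : NSubset N r × Equiv.Perm (Fin r) => (x.1.emb ∘ x.2 : _ → _)) := by
  rintro ⟨K, σ⟩ ⟨K', σ'⟩ h
  simp only at h
  have hK : K = K' := by
    apply Subtype.ext
    apply Finset.coe_injective
    rw [← K.range_emb, ← K'.range_emb, ← σ.surjective.range_comp, h, σ'.surjective.range_comp]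
  subst hK
  have : σ = σ' := by
    ext1 p
    exact K.emb.injective (congrFun h p)
  rw [this]

/-- The Cauchy–Binet formula. -/
theorem det_mul_eq_sum_minors {R : Type*} [CommRing R] {N r : ℕ}
    (P : Matrix (Fin r) (Fin N) R) (Q : Matrix (Fin N) (Fin r) R) :
    (P * Q).det =
      ∑ K : NSubset N r, (P.submatrix id K.emb).det * (Q.submatrix K.emb id).det := by
  have h1 : (P * Q).det =
      ∑ f : Fin r → Fin N, (∏ p, P p (f p)) * (Q.submatrix f id).det := by
    -- Each row of `P * Q` is a combination of rows of `Q`; expand the determinant multilinearly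
    -- over all choices `f` of rows.
    have h : P * Q = fun p => ∑ k, P p k • Q k := by
      ext p q
      simp [Matrix.mul_apply]
    rw [h]
    change Matrix.detRowAlternating (fun p => ∑ k, P p k • Q k) = _
    rw [← AlternatingMap.coe_multilinearMap, MultilinearMap.map_sum]
    refine Finset.sum_congr rfl fun f _ => ?_
    rw [MultilinearMap.map_smul_univ]
    rfl
  have h2 : ∀ K : NSubset N r, (P.submatrix id K.emb).det * (Q.submatrix K.emb id).det =
      ∑ σ : Equiv.Perm (Fin r),
        (∏ p, P p (K.emb (σ p))) * (Q.submatrix (K.emb ∘ σ) id).det := by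
    intro K
    have h3 : ∀ σ : Equiv.Perm (Fin r), (Q.submatrix (K.emb ∘ σ) id).det =
        Equiv.Perm.sign σ * (Q.submatrix K.emb id).det := by
      intro σ
      rw [← Matrix.det_permute]
      rfl
    simp_rw [h3]
    rw [← Matrix.det_transpose, Matrix.det_apply', Finset.sum_mul]
    refine Finset.sum_congr rfl fun σ _ => ?_
    simp only [Matrix.transpose_apply, Matrix.submatrix_apply, id]
    ring
  rw [h1]
  simp_rw [h2]
  rw [← Fintype.sum_prod_type' (f := fun (K : NSubset N r) (σ : Equiv.Perm (Fin r)) =>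
    (∏ p, P p (K.emb (σ p))) * (Q.submatrix (K.emb ∘ σ) id).det)]
  symm
  -- Injective `f` are exactly the `K.emb ∘ σ`; any other `f` repeats a row of `Q` and contributes
  -- zero.
  refine Fintype.sum_of_injective _ emb_comp_perm_injective _ _ ?_ (fun _ => rfl)
  intro f hf
  have hni : ¬ Function.Injective f := by
    intro hinj
    obtain ⟨K, σ, h⟩ := exists_eq_emb_comp_perm f hinj
    exact hf ⟨(K, σ), h⟩
  rw [Function.not_injective_iff] at hni
  obtain ⟨i, j, hij, hne⟩ := hni
  rw [Matrix.det_zero_of_row_eq hne, mul_zero]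
  ext q
  simp [hij]

theorem det_one_submatrix_emb {R : Type*} [CommRing R] {N r : ℕ} (I K : NSubset N r) :
    ((1 : Matrix (Fin N) (Fin N) R).submatrix I.emb K.emb).det = if I = K then 1 else 0 := by
  split_ifs with h
  · subst h
    rw [Matrix.submatrix_one _ I.emb.injective, Matrix.det_one]
  · have : ¬ I.1 ⊆ K.1 := fun hs =>
      h (Subtype.ext (Finset.eq_of_subset_of_card_le hs (by rw [I.2, K.2])))
    obtain ⟨x, hxI, hxK⟩ := Finset.not_subset.mp this
    have hx : x ∈ Set.range I.emb := by rw [I.range_emb]; exact hxI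
    obtain ⟨p, rfl⟩ := hx
    apply Matrix.det_eq_zero_of_row_eq_zero p
    intro q
    rw [Matrix.submatrix_apply, Matrix.one_apply_ne]
    intro he
    apply hxK
    rw [he]
    have : K.emb q ∈ Set.range K.emb := ⟨q, rfl⟩
    rwa [K.range_emb] at this

/-! ### Splitting subsets and compositions at the first element or part. -/

/-- An `n`-subset of `{1, …, N}`, shifted to avoid the first element. -/
def NSubset.shift {N n : ℕ} (I : NSubset N n) : NSubset (N + 1) n :=
  .ofStrictMono (Fin.succ ∘ I.emb) (Fin.strictMono_succ.comp I.emb.strictMono)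

theorem strictMono_cons_zero_succ {N n : ℕ} (f : Fin n ↪o Fin N) :
    StrictMono (Fin.cons 0 (Fin.succ ∘ f) : Fin (n + 1) → Fin (N + 1)) := by
  intro a b h
  induction a using Fin.cases with
  | zero =>
    induction b using Fin.cases with
    | zero => exact absurd h (lt_irrefl _)
    | succ b => simp
  | succ a =>
    induction b using Fin.cases with
    | zero => exact absurd h (Fin.not_lt_zero _)
    | succ b =>
      have h' : a < b := Fin.succ_lt_succ_iff.mp h
      simpa using h'

/-- Shift an `n`-subset of `{1, …, N}` and add the first element. -/
def NSubset.shiftCons {N n : ℕ} (I : NSubset N n) : NSubset (N + 1) (n + 1) :=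
  .ofStrictMono (Fin.cons 0 (Fin.succ ∘ I.emb)) (strictMono_cons_zero_succ _)

@[simp] theorem NSubset.emb_shift {N n : ℕ} (I : NSubset N n) :
    ⇑I.shift.emb = Fin.succ ∘ I.emb := NSubset.emb_ofStrictMono _ _

@[simp] theorem NSubset.emb_shiftCons {N n : ℕ} (I : NSubset N n) :
    ⇑I.shiftCons.emb = Fin.cons 0 (Fin.succ ∘ I.emb) := NSubset.emb_ofStrictMono _ _

theorem NSubset.lt_iff {N n : ℕ} (I J : NSubset N n) :
    I < J ↔ ∃ p, (∀ q, q < p → I.emb q = J.emb q) ∧ I.emb p < J.emb p := Iff.rfl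

theorem WeakComp.lt_iff {s n : ℕ} (μ ν : WeakComp s n) :
    μ < ν ↔ ∃ p, (∀ q, q < p → ν.1 q = μ.1 q) ∧ ν.1 p < μ.1 p := Iff.rfl

theorem strictMono_sumLexElim {α β γ : Type*} [Preorder α] [Preorder β] [Preorder γ]
    {f : α → γ} {g : β → γ} (hf : StrictMono f) (hg : StrictMono g) (h : ∀ a b, f a < g b) :
    StrictMono (fun x : α ⊕ₗ β => Sum.elim f g (ofLex x)) := by
  intro x y hxy
  induction x using Lex.rec with | _ x
  induction y using Lex.rec with | _ y
  cases x <;> cases y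
  · exact hf (Sum.Lex.inl_lt_inl_iff.mp hxy)
  · exact h _ _
  · exact absurd hxy Sum.Lex.not_inr_lt_inl
  · exact hg (Sum.Lex.inr_lt_inr_iff.mp hxy)

theorem exists_orderIso_of_strictMono {α β : Type*} [Fintype α] [Fintype β] [LinearOrder α]
    [Preorder β] {f : α → β} (hf : StrictMono f) (h : Fintype.card α = Fintype.card β) :
    ∃ e : α ≃o β, ⇑e = f :=
  ⟨StrictMono.orderIsoOfSurjective f hf
    ((Fintype.bijective_iff_injective_and_card f).mpr ⟨hf.injective, h⟩).2, rfl⟩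

/-- Subsets containing the first element precede all others lexicographically; Pascal's rule gives
surjectivity. -/
theorem NSubset.exists_orderIso_sumLex (N n : ℕ) :
    ∃ e : NSubset N n ⊕ₗ NSubset N (n + 1) ≃o NSubset (N + 1) (n + 1),
      ⇑e = fun x => Sum.elim NSubset.shiftCons NSubset.shift (ofLex x) := by
  apply exists_orderIso_of_strictMono
  · apply strictMono_sumLexElim
    · intro I J h
      obtain ⟨p, h1, h2⟩ := (NSubset.lt_iff _ _).mp h
      refine (NSubset.lt_iff _ _).mpr ⟨p.succ, fun q hq => ?_, by simpa using h2⟩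
      induction q using Fin.cases with
      | zero => simp
      | succ q => simpa using h1 q (Fin.succ_lt_succ_iff.mp hq)
    · intro I J h
      obtain ⟨p, h1, h2⟩ := (NSubset.lt_iff _ _).mp h
      exact (NSubset.lt_iff _ _).mpr
        ⟨p, fun q hq => by simpa using h1 q hq, by simpa using h2⟩
    · intro I J
      exact (NSubset.lt_iff _ _).mpr
        ⟨0, fun q hq => absurd hq (Fin.not_lt_zero _), by simp⟩
  · rw [NSubset.card_eq]
    change Fintype.card (NSubset N n ⊕ NSubset N (n + 1)) = _
    rw [Fintype.card_sum, NSubset.card_eq, NSubset.card_eq, Nat.choose_succ_succ]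

/-- Add one to the first part of a composition. -/
def WeakComp.incr {s n : ℕ} (μ : WeakComp (s + 1) n) : WeakComp (s + 1) (n + 1) :=
  ⟨Fin.cons (μ.1 0 + 1) (Fin.tail μ.1), by
    have := μ.2
    rw [Fin.sum_univ_succ] at this ⊢
    simp only [Fin.cons_zero, Fin.cons_succ, Fin.tail]
    omega⟩

/-- Prepend a zero part to a composition. -/
def WeakComp.consZero {s n : ℕ} (μ : WeakComp s n) : WeakComp (s + 1) n :=
  ⟨Fin.cons 0 μ.1, by
    have := μ.2
    rw [Fin.sum_univ_succ]
    simpa⟩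

/-- The order is decreasing lexicographic, so compositions with positive first part come first. This
matches the splitting of `NSubset` block by block. -/
theorem WeakComp.exists_orderIso_sumLex (s n : ℕ) :
    ∃ e : WeakComp (s + 1) n ⊕ₗ WeakComp s (n + 1) ≃o WeakComp (s + 1) (n + 1),
      ⇑e = fun x => Sum.elim WeakComp.incr WeakComp.consZero (ofLex x) := by
  apply exists_orderIso_of_strictMono
  · apply strictMono_sumLexElim
    · intro μ ν h
      obtain ⟨p, h1, h2⟩ := (WeakComp.lt_iff _ _).mp h
      refine (WeakComp.lt_iff _ _).mpr ⟨p, fun q hq => ?_, ?_⟩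
      · have := h1 q hq
        induction q using Fin.cases with
        | zero => simpa [WeakComp.incr] using this
        | succ q => simpa [WeakComp.incr, Fin.tail] using this
      · induction p using Fin.cases with
        | zero => simpa [WeakComp.incr] using h2
        | succ q => simpa [WeakComp.incr, Fin.tail] using h2
    · intro μ ν h
      obtain ⟨p, h1, h2⟩ := (WeakComp.lt_iff _ _).mp h
      refine (WeakComp.lt_iff _ _).mpr ⟨p.succ, fun q hq => ?_, by simpa [WeakComp.consZero] using h2⟩
      induction q using Fin.cases with
      | zero => simp [WeakComp.consZero]
      | succ q => simpa [WeakComp.consZero] using h1 q (Fin.succ_lt_succ_iff.mp hq)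
    · intro μ ν
      exact (WeakComp.lt_iff _ _).mpr
        ⟨0, fun q hq => absurd hq (Fin.not_lt_zero _), by simp [WeakComp.incr, WeakComp.consZero]⟩
  · rw [WeakComp.card_eq]
    change Fintype.card (WeakComp (s + 1) n ⊕ WeakComp s (n + 1)) = _
    rw [Fintype.card_sum, WeakComp.card_eq, WeakComp.card_eq,
      show s + 1 + (n + 1) - 1 = s + n + 1 by omega, show s + 1 + n - 1 = s + n by omega,
      show s + (n + 1) - 1 = s + n by omega, Nat.choose_succ_succ]

/-- Add one to the first part of a composition into positive parts. -/
def PosComp.incr {s m : ℕ} (μ : PosComp (s + 1) m) : PosComp (s + 1) (m + 1) :=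
  ⟨Fin.cons (μ.1 0 + 1) (Fin.tail μ.1), by
    have := μ.2.1
    rw [Fin.sum_univ_succ] at this ⊢
    simp only [Fin.cons_zero, Fin.cons_succ, Fin.tail]
    omega, fun i => by
    induction i using Fin.cases with
    | zero => simp
    | succ i => simpa [Fin.tail] using μ.2.2 i.succ⟩

/-- Prepend a part equal to one to a composition. -/
def PosComp.consOne {s m : ℕ} (μ : PosComp s m) : PosComp (s + 1) (m + 1) :=
  ⟨Fin.cons 1 μ.1, by
    have := μ.2.1
    rw [Fin.sum_univ_succ]
    simp only [Fin.cons_zero, Fin.cons_succ]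
    omega, fun i => by
    induction i using Fin.cases with
    | zero => simp
    | succ i => simpa using μ.2.2 i⟩

theorem PosComp.bijective_sumElim (s m : ℕ) :
    Function.Bijective (Sum.elim PosComp.incr PosComp.consOne :
      PosComp (s + 1) m ⊕ PosComp s m → PosComp (s + 1) (m + 1)) := by
  constructor
  · apply Function.Injective.sumElim
    · intro μ ν h
      have h' : (Fin.cons (μ.1 0 + 1) (Fin.tail μ.1) : Fin (s + 1) → ℕ) =
          Fin.cons (ν.1 0 + 1) (Fin.tail ν.1) := congrArg Subtype.val h
      rw [Fin.cons_inj] at h'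
      apply Subtype.ext
      rw [← Fin.cons_self_tail μ.1, ← Fin.cons_self_tail ν.1, h'.2, Nat.succ_injective h'.1]
    · intro μ ν h
      have h' : (Fin.cons 1 μ.1 : Fin (s + 1) → ℕ) = Fin.cons 1 ν.1 := congrArg Subtype.val h
      exact Subtype.ext (Fin.cons_inj.mp h').2
    · intro μ ν h
      have h' : (Fin.cons (μ.1 0 + 1) (Fin.tail μ.1) : Fin (s + 1) → ℕ) = Fin.cons 1 ν.1 :=
        congrArg Subtype.val h
      rw [Fin.cons_inj] at h'
      have := μ.2.2 0
      omega
  · intro ν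
    have h0 := ν.2.2 0
    have hs := ν.2.1
    rw [Fin.sum_univ_succ] at hs
    obtain h | h := (Nat.succ_le_of_lt h0).eq_or_lt
    · refine ⟨.inr ⟨Fin.tail ν.1, ?_, fun i => ν.2.2 i.succ⟩, ?_⟩
      · simp only [Fin.tail]
        omega
      · apply Subtype.ext
        change Fin.cons 1 (Fin.tail ν.1) = ν.1
        conv_rhs => rw [← Fin.cons_self_tail ν.1]
        rw [← h]
    · refine ⟨.inl ⟨Fin.cons (ν.1 0 - 1) (Fin.tail ν.1), ?_, fun i => ?_⟩, ?_⟩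
      · rw [Fin.sum_univ_succ]
        simp only [Fin.cons_zero, Fin.cons_succ, Fin.tail]
        omega
      · induction i using Fin.cases with
        | zero => simp only [Fin.cons_zero]; omega
        | succ i => simpa [Fin.tail] using ν.2.2 i.succ
      · apply Subtype.ext
        change Fin.cons (ν.1 0 - 1 + 1) (Fin.tail ν.1) = ν.1
        conv_rhs => rw [← Fin.cons_self_tail ν.1]
        rw [Nat.sub_add_cancel h0]

/-- Counts the factors on the right side, hence the power of `det g` acquired under multiplication
by `g`. -/
theorem PosComp.card_eq (s m : ℕ) : Fintype.card (PosComp (s + 1) (m + 1)) = m.choose s := by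
  induction m generalizing s with
  | zero =>
    rw [← Fintype.card_of_bijective (PosComp.bijective_sumElim s 0), Fintype.card_sum]
    have h1 : ∀ t, IsEmpty (PosComp (t + 1) 0) := fun t => ⟨fun μ => by
      have := μ.2.1
      rw [Fin.sum_univ_succ] at this
      have := μ.2.2 0
      omega⟩
    cases s with
    | zero =>
      have h2 : Fintype.card (PosComp 0 0) = 1 :=
        Fintype.card_eq_one_iff.mpr ⟨⟨fun i => i.elim0, by simp, fun i => i.elim0⟩,
          fun y => Subtype.ext (funext fun i => i.elim0)⟩
      rw [h2]
      simp
    | succ s => simp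
  | succ m ih =>
    rw [← Fintype.card_of_bijective (PosComp.bijective_sumElim s (m + 1)), Fintype.card_sum, ih]
    cases s with
    | zero =>
      have : IsEmpty (PosComp 0 (m + 1)) := ⟨fun μ => by simpa using μ.2.1⟩
      simp
    | succ s => rw [ih, Nat.choose_succ_succ, add_comm]

/-! ### Minors of concatenated sequences of vectors. -/

/-- Concatenation of the first `μ k` terms of the sequences `v k`. -/
def blockList {C : Type*} {s : ℕ} (v : Fin s → ℕ → C) (μ : Fin s → ℕ) : List C :=
  (List.finRange s).flatMap fun k => (List.range (μ k)).map (v k)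

/-- Drop the first term of the first sequence. -/
def dropHead {C : Type*} {s : ℕ} (v : Fin (s + 1) → ℕ → C) : Fin (s + 1) → ℕ → C :=
  Fin.cons (fun j => v 0 (j + 1)) (Fin.tail v)

theorem blockList_cons_zero {C : Type*} {s : ℕ} (v : Fin (s + 1) → ℕ → C) (μ : Fin s → ℕ) :
    blockList v (Fin.cons 0 μ) = blockList (Fin.tail v) μ := by
  simp [blockList, List.finRange_succ, List.flatMap_map, Fin.tail]

theorem blockList_cons_succ {C : Type*} {s : ℕ} (v : Fin (s + 1) → ℕ → C)
    (μ : Fin (s + 1) → ℕ) :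
    blockList v (Fin.cons (μ 0 + 1) (Fin.tail μ)) = v 0 0 :: blockList (dropHead v) μ := by
  simp [blockList, List.finRange_succ, List.flatMap_map, Fin.tail, dropHead,
    List.range_succ_eq_map, Function.comp_def]

theorem blockList_cons_one {C : Type*} {s : ℕ} (v : Fin (s + 1) → ℕ → C) (μ : Fin s → ℕ) :
    blockList v (Fin.cons 1 μ) = v 0 0 :: blockList (Fin.tail v) μ := by
  simp [blockList, List.finRange_succ, List.flatMap_map, Fin.tail]

theorem map_blockList {C D : Type*} (f : C → D) {s : ℕ} (v : Fin s → ℕ → C) (μ : Fin s → ℕ) :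
    (blockList v μ).map f = blockList (fun k j => f (v k j)) μ := by
  simp [blockList, List.map_flatMap, Function.comp_def]

theorem length_blockList {C : Type*} {s : ℕ} (v : Fin s → ℕ → C) (μ : Fin s → ℕ) :
    (blockList v μ).length = ∑ k, μ k := by
  simp [blockList, List.length_flatMap, Fin.sum_univ_def]

/-- The matrix whose columns are the first `r` vectors of a list. -/
def colMatrix {R : Type*} [Zero R] {N : ℕ} (l : List (Fin N → R)) (r : ℕ) :
    Matrix (Fin N) (Fin r) R :=
  Matrix.of fun i q => l.getD q 0 i

variable {R : Type*} [CommRing R]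

theorem colMatrix_map_mulVec {M N r : ℕ} (g : Matrix (Fin M) (Fin N) R)
    (l : List (Fin N → R)) : colMatrix (l.map g.mulVec) r = g * colMatrix l r := by
  ext i q
  simp only [colMatrix, Matrix.of_apply, Matrix.mul_apply, List.getD_eq_getElem?_getD,
    List.getElem?_map]
  cases l[q.1]? <;> simp [Matrix.mulVec, dotProduct]

theorem colMatrix_map_ringHom {S : Type*} [CommRing S] {N r : ℕ} (φ : R →+* S)
    (l : List (Fin N → R)) :
    colMatrix (l.map fun c i => φ (c i)) r = (colMatrix l r).map φ := by
  ext i q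
  simp only [colMatrix, Matrix.of_apply, Matrix.map_apply, List.getD_eq_getElem?_getD,
    List.getElem?_map]
  cases l[q.1]? <;> simp

theorem colMatrix_map_tail {N r : ℕ} (l : List (Fin (N + 1) → R)) :
    colMatrix (l.map Fin.tail) r = (colMatrix l r).submatrix Fin.succ id := by
  ext i q
  simp only [colMatrix, Matrix.of_apply, Matrix.submatrix_apply, List.getD_eq_getElem?_getD,
    List.getElem?_map, id]
  rcases l[q.1]? with _ | c
  · rfl
  · rfl

/-- Laplace expansion along the first column, which is a basis vector. -/
theorem det_colMatrix_cons_single {N r : ℕ} (l : List (Fin (N + 1) → R)) (f : Fin r → Fin N) :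
    ((colMatrix (Pi.single 0 1 :: l) (r + 1)).submatrix
      (Fin.cons 0 (Fin.succ ∘ f) : Fin (r + 1) → Fin (N + 1)) id).det =
      ((colMatrix (l.map Fin.tail) r).submatrix f id).det := by
  rw [Matrix.det_succ_column_zero, Fin.sum_univ_succ, Finset.sum_eq_zero, add_zero,
    colMatrix_map_tail]
  · simp only [colMatrix]
    simp
    rfl
  · intro i _
    simp [colMatrix]

theorem det_colMatrix_cons_single_succ {N r : ℕ} (l : List (Fin (N + 1) → R))
    (f : Fin (r + 1) → Fin N) :
    ((colMatrix (Pi.single 0 1 :: l) (r + 1)).submatrix (Fin.succ ∘ f) id).det = 0 :=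
  Matrix.det_eq_zero_of_column_eq_zero 0 fun i => by simp [colMatrix]

theorem det_colMatrix_cons_single_self {N : ℕ} (l : List (Fin (N + 1) → R)) :
    (colMatrix (Pi.single 0 1 :: l) (N + 1)).det = (colMatrix (l.map Fin.tail) N).det := by
  have h := det_colMatrix_cons_single l (id : Fin N → Fin N)
  have h1 : (Fin.cons 0 (Fin.succ ∘ id) : Fin (N + 1) → Fin (N + 1)) = id := by
    ext i
    induction i using Fin.cases <;> simp
  rw [h1] at h
  simpa using h

/-- The `n`-minors of the matrices with columns `blockList v μ`. -/
def blockMinors {s N n : ℕ} (v : Fin s → ℕ → Fin N → R) (I : NSubset N n)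
    (μ : WeakComp s n) : R :=
  ((colMatrix (blockList v μ.1) n).submatrix I.emb id).det

/-- The maximal minor with columns `blockList v ν`. -/
def blockDet {s N : ℕ} (v : Fin s → ℕ → Fin N → R) (ν : PosComp s N) : R :=
  (colMatrix (blockList v ν.1) N).det

/-- The compound determinant identity for a family of sequences of vectors. -/
def CompoundIdentity {s N : ℕ} (n : ℕ) (v : Fin s → ℕ → Fin N → R) : Prop :=
  ∀ e : WeakComp s n ≃o NSubset N n,
    (Matrix.of fun lam μ => blockMinors v (e lam) μ).det = ∏ ν : PosComp s N, blockDet v ν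

/-! ### Effect of a linear change of coordinates on both sides. -/

/-- The matrix with first column `x` and the other columns those of the identity. -/
def firstColMatrix {N : ℕ} (x : Fin (N + 1) → R) : Matrix (Fin (N + 1)) (Fin (N + 1)) R :=
  Matrix.of fun i => Fin.cons (x i) (fun j => if i = j.succ then 1 else 0)

theorem firstColMatrix_mulVec_single {N : ℕ} (x : Fin (N + 1) → R) :
    (firstColMatrix x).mulVec (Pi.single 0 1) = x := by
  ext i
  simp [firstColMatrix]

theorem det_firstColMatrix_cons {N r : ℕ} (x : Fin (N + 1) → R) (f g : Fin r → Fin N) :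
    ((firstColMatrix x).submatrix (Fin.cons 0 (Fin.succ ∘ f) : Fin (r + 1) → Fin (N + 1))
      (Fin.cons 0 (Fin.succ ∘ g) : Fin (r + 1) → Fin (N + 1))).det =
      x 0 * ((1 : Matrix (Fin N) (Fin N) R).submatrix f g).det := by
  rw [Matrix.det_succ_row_zero, Fin.sum_univ_succ, Finset.sum_eq_zero, add_zero]
  · simp only [firstColMatrix]
    simp
    congr 2
    ext i j
    simp [Matrix.one_apply]
  · intro i _
    simp [firstColMatrix, (Fin.succ_ne_zero _).symm]

theorem det_firstColMatrix {N : ℕ} (x : Fin (N + 1) → R) : (firstColMatrix x).det = x 0 := by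
  have h := det_firstColMatrix_cons x (id : Fin N → Fin N) id
  have h1 : (Fin.cons 0 (Fin.succ ∘ id) : Fin (N + 1) → Fin (N + 1)) = id := by
    ext i
    induction i using Fin.cases <;> simp
  rw [h1] at h
  simpa using h

theorem det_firstColMatrix_cons_succ {N r : ℕ} (x : Fin (N + 1) → R) (f : Fin r → Fin N)
    (g : Fin (r + 1) → Fin N) :
    ((firstColMatrix x).submatrix (Fin.cons 0 (Fin.succ ∘ f) : Fin (r + 1) → Fin (N + 1))
      (Fin.succ ∘ g)).det = 0 :=
  Matrix.det_eq_zero_of_row_eq_zero 0 fun j => by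
    simp [firstColMatrix, (Fin.succ_ne_zero _).symm]

theorem det_firstColMatrix_succ {N r : ℕ} (x : Fin (N + 1) → R) (f g : Fin r → Fin N) :
    ((firstColMatrix x).submatrix (Fin.succ ∘ f) (Fin.succ ∘ g)).det =
      ((1 : Matrix (Fin N) (Fin N) R).submatrix f g).det := by
  congr 1
  ext i j
  simp [firstColMatrix, Matrix.one_apply]

/-- The `n`-th compound of a square matrix. -/
def compound {N : ℕ} (g : Matrix (Fin N) (Fin N) R) (n : ℕ) :
    Matrix (NSubset N n) (NSubset N n) R :=
  Matrix.of fun I K => (g.submatrix I.emb K.emb).det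

theorem blockMinors_mulVec {s N n : ℕ} (g : Matrix (Fin N) (Fin N) R)
    (v : Fin s → ℕ → Fin N → R) (I : NSubset N n) (μ : WeakComp s n) :
    blockMinors (fun k j => g.mulVec (v k j)) I μ =
      ∑ K : NSubset N n, compound g n I K * blockMinors v K μ := by
  rw [blockMinors, ← map_blockList, colMatrix_map_mulVec,
    Matrix.submatrix_mul _ _ _ id _ Function.bijective_id, det_mul_eq_sum_minors]
  rfl

theorem blockDet_mulVec {s N : ℕ} (g : Matrix (Fin N) (Fin N) R)
    (v : Fin s → ℕ → Fin N → R) (ν : PosComp s N) :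
    blockDet (fun k j => g.mulVec (v k j)) ν = g.det * blockDet v ν := by
  rw [blockDet, ← map_blockList, colMatrix_map_mulVec, Matrix.det_mul]
  rfl

/-- Row `0` of the matrix is `(x 0, 0, …, 0)`, so the compound is block lower triangular: `x 0`
times the identity on subsets containing the first element, and the identity on the rest. -/
theorem det_compound_firstColMatrix {N : ℕ} (n : ℕ) (x : Fin (N + 1) → R) :
    (compound (firstColMatrix x) (n + 1)).det = x 0 ^ N.choose n := by
  obtain ⟨e, he⟩ := NSubset.exists_orderIso_sumLex N n
  rw [← Matrix.det_submatrix_equiv_self (toLex.trans e.toEquiv)]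
  have h : (compound (firstColMatrix x) (n + 1)).submatrix (toLex.trans e.toEquiv)
      (toLex.trans e.toEquiv) =
      Matrix.fromBlocks (x 0 • (1 : Matrix (NSubset N n) (NSubset N n) R)) 0
        (Matrix.of fun I K => compound (firstColMatrix x) (n + 1) (NSubset.shift I)
          (NSubset.shiftCons K)) 1 := by
    have he1 : ∀ I, e (toLex (Sum.inl I)) = NSubset.shiftCons I := fun I => by rw [he]; rfl
    have he2 : ∀ I, e (toLex (Sum.inr I)) = NSubset.shift I := fun I => by rw [he]; rfl
    ext I K
    rcases I with I | I <;> rcases K with K | K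
    · simp [he1, compound, det_firstColMatrix_cons, det_one_submatrix_emb, Matrix.one_apply]
    · simp [he1, he2, compound, det_firstColMatrix_cons_succ]
    · simp [he1, he2]
    · simp [he2, compound, det_firstColMatrix_succ, det_one_submatrix_emb, Matrix.one_apply]
  rw [h, Matrix.det_fromBlocks_zero₁₂, Matrix.det_smul, Matrix.det_one, Matrix.det_one,
    NSubset.card_eq, mul_one, mul_one]

/-- The left side gains `x 0 ^ N.choose n` and the right side `x 0 ^ N.choose s`; these agree
because `s + n = N`. -/
theorem CompoundIdentity.firstColMatrix_mulVec {s n N : ℕ} (hN : s + n = N)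
    {v : Fin (s + 1) → ℕ → Fin (N + 1) → R} (hv : CompoundIdentity (n + 1) v)
    (x : Fin (N + 1) → R) :
    CompoundIdentity (n + 1) (fun k j => (firstColMatrix x).mulVec (v k j)) := by
  intro e
  have h : (Matrix.of fun lam μ =>
        blockMinors (fun k j => (firstColMatrix x).mulVec (v k j)) (e lam) μ) =
      (compound (firstColMatrix x) (n + 1)).submatrix e.toEquiv e.toEquiv *
        Matrix.of fun lam μ => blockMinors v (e lam) μ := by
    ext lam μ
    rw [Matrix.of_apply, blockMinors_mulVec, Matrix.mul_apply]
    exact (e.toEquiv.sum_comp _).symm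
  simp_rw [h, blockDet_mulVec]
  rw [Matrix.det_mul, Matrix.det_submatrix_equiv_self, det_compound_firstColMatrix, hv e,
    Finset.prod_mul_distrib, Finset.prod_const, Finset.card_univ, PosComp.card_eq,
    det_firstColMatrix]
  have hc : N.choose n = N.choose s := by rw [← hN, Nat.choose_symm_add]
  rw [hc]

/-! ### The inductive step. -/

theorem compoundIdentity_of_head_eq_single {s n N : ℕ} (hN : s + n = N)
    (v : Fin (s + 1) → ℕ → Fin (N + 1) → R) (hv : v 0 0 = Pi.single 0 1)
    (ih₁ : CompoundIdentity n fun k j => Fin.tail (dropHead v k j))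
    (ih₂ : CompoundIdentity (n + 1) fun k j => Fin.tail (Fin.tail v k j)) :
    CompoundIdentity (n + 1) v := by
  intro e
  obtain ⟨r, hr⟩ := NSubset.exists_orderIso_sumLex N n
  obtain ⟨c, hc⟩ := WeakComp.exists_orderIso_sumLex s n
  have hr1 : ∀ I, r (toLex (Sum.inl I)) = NSubset.shiftCons I := fun I => by rw [hr]; rfl
  have hr2 : ∀ I, r (toLex (Sum.inr I)) = NSubset.shift I := fun I => by rw [hr]; rfl
  have hc1 : ∀ I, c (toLex (Sum.inl I)) = WeakComp.incr I := fun I => by rw [hc]; rfl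
  have hc2 : ∀ I, c (toLex (Sum.inr I)) = WeakComp.consZero I := fun I => by rw [hc]; rfl
  let e₁ : WeakComp (s + 1) n ≃o NSubset N n :=
    (Fintype.orderIsoFinOfCardEq _ (WeakComp.card_eq _ _)).symm.trans
      (Fintype.orderIsoFinOfCardEq _ (by
        rw [NSubset.card_eq, ← hN, show s + 1 + n - 1 = s + n by omega]))
  let e₂ : WeakComp s (n + 1) ≃o NSubset N (n + 1) :=
    (Fintype.orderIsoFinOfCardEq _ (WeakComp.card_eq _ _)).symm.trans
      (Fintype.orderIsoFinOfCardEq _ (by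
        rw [NSubset.card_eq, ← hN, show s + (n + 1) - 1 = s + n by omega]))
  have he : e = c.symm.trans ((OrderIso.sumLexCongr e₁ e₂).trans r) := Subsingleton.elim _ _
  have hec : ∀ x, e (c x) = r (OrderIso.sumLexCongr e₁ e₂ x) := by
    intro x
    rw [he]
    simp
  have he1 : ∀ μ, e (WeakComp.incr μ) = NSubset.shiftCons (e₁ μ) := by
    intro μ
    rw [← hc1, hec, ← hr1]
    rfl
  have he2 : ∀ μ, e (WeakComp.consZero μ) = NSubset.shift (e₂ μ) := by
    intro μ
    rw [← hc2, hec, ← hr2]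
    rfl
  have hl1 : ∀ μ : WeakComp (s + 1) n, blockList v μ.incr.1 =
      Pi.single 0 1 :: blockList (dropHead v) μ.1 := by
    intro μ
    rw [← hv]
    exact blockList_cons_succ v μ.1
  have hl2 : ∀ μ : WeakComp s (n + 1), blockList v μ.consZero.1 = blockList (Fin.tail v) μ.1 :=
    fun μ => blockList_cons_zero v μ.1
  rw [← Matrix.det_submatrix_equiv_self (toLex.trans c.toEquiv)]
  have h : (Matrix.of fun lam μ => blockMinors v (e lam) μ).submatrix (toLex.trans c.toEquiv)
      (toLex.trans c.toEquiv) =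
      Matrix.fromBlocks
        (Matrix.of fun lam μ => blockMinors (fun k j => Fin.tail (dropHead v k j)) (e₁ lam) μ)
        (Matrix.of fun lam μ => blockMinors v (e (WeakComp.incr lam)) (WeakComp.consZero μ)) 0
        (Matrix.of fun lam μ =>
          blockMinors (fun k j => Fin.tail (Fin.tail v k j)) (e₂ lam) μ) := by
    ext lam μ
    rcases lam with lam | lam <;> rcases μ with μ | μ
    · simp [hc1, he1, blockMinors, hl1, det_colMatrix_cons_single, map_blockList]
    · simp [hc1, hc2]
    · simp [hc1, hc2, he2, blockMinors, hl1, det_colMatrix_cons_single_succ]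
    · change blockMinors v (e (c (toLex (Sum.inr lam)))) (c (toLex (Sum.inr μ))) =
        blockMinors (fun k j => Fin.tail (Fin.tail v k j)) (e₂ lam) μ
      rw [hc2, hc2, he2, blockMinors, blockMinors, hl2, NSubset.emb_shift]
      rw [← map_blockList Fin.tail, colMatrix_map_tail]
      rfl
  rw [h, Matrix.det_fromBlocks_zero₂₁, ih₁ e₁, ih₂ e₂,
    ← (Equiv.ofBijective _ (PosComp.bijective_sumElim s N)).prod_comp, Fintype.prod_sum_type]
  congr 1
  · refine Finset.prod_congr rfl fun ν _ => ?_
    change _ = (colMatrix (blockList v (Fin.cons (ν.1 0 + 1) (Fin.tail ν.1))) (N + 1)).det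
    rw [blockList_cons_succ, hv, det_colMatrix_cons_single_self, map_blockList]
    rfl
  · refine Finset.prod_congr rfl fun ν _ => ?_
    change _ = (colMatrix (blockList v (Fin.cons 1 ν.1)) (N + 1)).det
    rw [blockList_cons_one, hv, det_colMatrix_cons_single_self, map_blockList]
    rfl

/-- `firstColMatrix (v 0 0)` sends `e₀` to `v 0 0` and is invertible here: apply its inverse to
reach the case of head `e₀`, then transport back. -/
theorem compoundIdentity_of_isUnit {s n N : ℕ} (hN : s + n = N)
    (v : Fin (s + 1) → ℕ → Fin (N + 1) → R) (hu : IsUnit (v 0 0 0))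
    (ih₁ : ∀ w : Fin (s + 1) → ℕ → Fin N → R, CompoundIdentity n w)
    (ih₂ : ∀ w : Fin s → ℕ → Fin N → R, CompoundIdentity (n + 1) w) :
    CompoundIdentity (n + 1) v := by
  have hdet : IsUnit (firstColMatrix (v 0 0)).det := by rwa [det_firstColMatrix]
  have h := (compoundIdentity_of_head_eq_single hN
    (fun k j => (firstColMatrix (v 0 0))⁻¹.mulVec (v k j))
    (by
      conv_lhs => rw [← firstColMatrix_mulVec_single (v 0 0)]
      rw [Matrix.mulVec_mulVec, firstColMatrix_mulVec_single, Matrix.nonsing_inv_mul _ hdet,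
        Matrix.one_mulVec])
    (ih₁ _) (ih₂ _)).firstColMatrix_mulVec hN (v 0 0)
  simpa [Matrix.mulVec_mulVec, Matrix.mul_nonsing_inv _ hdet] using h

theorem blockMinors_map {S : Type*} [CommRing S] (φ : R →+* S) {s N n : ℕ}
    (v : Fin s → ℕ → Fin N → R) (I : NSubset N n) (μ : WeakComp s n) :
    blockMinors (fun k j i => φ (v k j i)) I μ = φ (blockMinors v I μ) := by
  rw [blockMinors, ← map_blockList (fun c : Fin N → R => fun i => φ (c i)), colMatrix_map_ringHom,
    blockMinors, RingHom.map_det]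
  rfl

theorem blockDet_map {S : Type*} [CommRing S] (φ : R →+* S) {s N : ℕ}
    (v : Fin s → ℕ → Fin N → R) (ν : PosComp s N) :
    blockDet (fun k j i => φ (v k j i)) ν = φ (blockDet v ν) := by
  rw [blockDet, ← map_blockList (fun c : Fin N → R => fun i => φ (c i)), colMatrix_map_ringHom,
    blockDet, RingHom.map_det]
  rfl

theorem compoundIdentity_map_iff {S : Type*} [CommRing S] (φ : R →+* S) {s n N : ℕ}
    (v : Fin s → ℕ → Fin N → R) :
    CompoundIdentity n (fun k j i => φ (v k j i)) ↔ ∀ e : WeakComp s n ≃o NSubset N n,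
      φ (Matrix.of fun lam μ => blockMinors v (e lam) μ).det = φ (∏ ν, blockDet v ν) := by
  refine forall_congr' fun e => ?_
  simp_rw [blockMinors_map, blockDet_map, RingHom.map_det, map_prod]
  rfl

theorem CompoundIdentity.of_map_injective {S : Type*} [CommRing S] {φ : R →+* S}
    (hφ : Function.Injective φ) {s n N : ℕ} {v : Fin s → ℕ → Fin N → R}
    (h : CompoundIdentity n (fun k j i => φ (v k j i))) : CompoundIdentity n v :=
  fun e => hφ ((compoundIdentity_map_iff φ v).mp h e)

theorem CompoundIdentity.map {S : Type*} [CommRing S] (φ : R →+* S)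
    {s n N : ℕ} {v : Fin s → ℕ → Fin N → R} (h : CompoundIdentity n v) :
    CompoundIdentity n (fun k j i => φ (v k j i)) :=
  (compoundIdentity_map_iff φ v).mpr fun e => congrArg φ (h e)

/-- The induction hypotheses range over all rings of the universe because they are used over a
localization of `R[X]`. -/
theorem compoundIdentity_succ.{u} {R : Type u} [CommRing R] {s n N : ℕ} (hN : s + n = N)
    (v : Fin (s + 1) → ℕ → Fin (N + 1) → R)
    (ih₁ : ∀ (S : Type u) [CommRing S] (w : Fin (s + 1) → ℕ → Fin N → S), CompoundIdentity n w)
    (ih₂ : ∀ (S : Type u) [CommRing S] (w : Fin s → ℕ → Fin N → S), CompoundIdentity (n + 1) w) :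
    CompoundIdentity (n + 1) v := by
  classical
  let p : Polynomial R := Polynomial.X + Polynomial.C (v 0 0 0)
  let w : Fin (s + 1) → ℕ → Fin (N + 1) → Polynomial R := fun k j i =>
    if k = 0 ∧ j = 0 ∧ i = 0 then p else Polynomial.C (v k j i)
  have hw : CompoundIdentity (n + 1) w := by
    -- `p` is monic, hence not a zero divisor even when `R` has zero divisors, so `R[X]` embeds in
    -- its localization at `p`.
    have hp : Submonoid.powers p ≤ nonZeroDivisors (Polynomial R) :=
      Submonoid.powers_le.mpr (Polynomial.monic_X_add_C _).mem_nonZeroDivisors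
    refine CompoundIdentity.of_map_injective
      (IsLocalization.injective (Localization.Away p) hp) ?_
    refine compoundIdentity_of_isUnit hN _ ?_ (ih₁ _) (ih₂ _)
    simpa [w] using IsLocalization.Away.algebraMap_isUnit p
  -- Setting `X = 0` turns `w` back into `v`.
  have h := hw.map (Polynomial.evalRingHom 0)
  convert h using 4 with k j i
  by_cases hkj : k = 0 ∧ j = 0 ∧ i = 0
  · obtain ⟨rfl, rfl, rfl⟩ := hkj
    simp [w, p]
  · simp [w, hkj]

/-! ### Base cases and the induction. -/

theorem compoundIdentity_zero_left {n N : ℕ} (hN : n = N + 1) (v : Fin 0 → ℕ → Fin N → R) :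
    CompoundIdentity n v := by
  subst hN
  intro e
  have : IsEmpty (WeakComp 0 (N + 1)) := ⟨fun μ => by simpa using μ.2⟩
  rw [Matrix.det_isEmpty, Finset.prod_eq_one]
  -- A `ν` with no parts exists only for `N = 0`, where its factor is the empty determinant.
  intro ν _
  have h : 0 = N := by simpa using ν.2.1
  subst h
  rw [blockDet, Matrix.det_isEmpty]

theorem compoundIdentity_zero_right {N : ℕ} (v : Fin (N + 1) → ℕ → Fin N → R) :
    CompoundIdentity 0 v := by
  intro e
  have h : Fintype.card (WeakComp (N + 1) 0) = 1 := by simp [WeakComp.card_eq]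
  obtain ⟨μ, hμ⟩ := Fintype.card_eq_one_iff.mp h
  have : Subsingleton (WeakComp (N + 1) 0) := ⟨fun a b => (hμ a).trans (hμ b).symm⟩
  have : IsEmpty (PosComp (N + 1) N) := ⟨fun ν => by
    have h1 : ∑ _i : Fin (N + 1), 1 ≤ ∑ i, ν.1 i := Finset.sum_le_sum fun i _ => ν.2.2 i
    rw [ν.2.1] at h1
    simp at h1⟩
  rw [Matrix.det_eq_elem_of_subsingleton _ μ, Finset.univ_eq_empty, Finset.prod_empty]
  rw [Matrix.of_apply, blockMinors, Matrix.det_isEmpty]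

/-- The compound determinant identity holds for all families of sequences of vectors. -/
theorem compoundIdentity {s n N : ℕ} (hN : s + n = N + 1) (R : Type*) [CommRing R]
    (v : Fin s → ℕ → Fin N → R) : CompoundIdentity n v := by
  induction N generalizing s n R with
  | zero =>
    obtain ⟨rfl, h⟩ | ⟨rfl, rfl⟩ := Nat.add_eq_one_iff.mp hN
    · exact compoundIdentity_zero_left h v
    · exact compoundIdentity_zero_right v
  | succ N ih =>
    obtain _ | s := s
    · exact compoundIdentity_zero_left (by omega) v
    obtain _ | n := n
    · obtain rfl : s = N + 1 := by omega
      exact compoundIdentity_zero_right v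
    · exact compoundIdentity_succ (by omega) v (fun S _ w => ih (by omega) S w)
        fun S _ w => ih (by omega) S w

/-! ### Return to the columns of `A`. -/

theorem mem_blockList_index {s n x : ℕ} (μ : Fin s → ℕ) :
    x ∈ blockList (fun (k : Fin s) j => k.1 * n + j) μ ↔
      ∃ k : Fin s, k.1 * n ≤ x ∧ x < k.1 * n + μ k := by
  simp only [blockList, List.mem_flatMap, List.mem_finRange, true_and, List.mem_map,
    List.mem_range]
  refine exists_congr fun k => ⟨?_, fun h => ⟨x - k.1 * n, by omega, by omega⟩⟩
  rintro ⟨j, hj, rfl⟩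
  omega

theorem pairwise_blockList_index {s n : ℕ} (μ : Fin s → ℕ) (hμ : ∀ k, μ k ≤ n) :
    (blockList (fun (k : Fin s) j => k.1 * n + j) μ).Pairwise (· < ·) := by
  rw [blockList, List.pairwise_flatMap]
  refine ⟨fun k _ => ?_, ?_⟩
  · rw [List.pairwise_map]
    exact List.pairwise_lt_range.imp fun h => by omega
  · refine (List.pairwise_lt_finRange s).imp ?_
    intro a b hab x hx y hy
    simp only [List.mem_map, List.mem_range] at hx hy
    obtain ⟨i, hi, rfl⟩ := hx
    obtain ⟨j, hj, rfl⟩ := hy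
    have h1 := hμ a
    have h2 : (a.1 + 1) * n ≤ b.1 * n := Nat.mul_le_mul_right n hab
    rw [Nat.add_mul] at h2
    omega

theorem getElem?_blockList_index {s n r : ℕ} (μ : Fin s → ℕ) (hμ : ∀ k, μ k ≤ n)
    (hr : ∑ k, μ k = r) (J : NSubset (s * n) r) (hJ : J.1 = iota n μ) (q : Fin r) :
    (blockList (fun (k : Fin s) j => k.1 * n + j) μ)[q.1]? = some (J.emb q).1 := by
  set l := blockList (fun (k : Fin s) j => k.1 * n + j) μ with hl
  have hlen : l.length = r := by rw [hl, length_blockList, hr]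
  have hlt : ∀ x ∈ l, x < s * n := by
    intro x hx
    obtain ⟨k, _, h2⟩ := (mem_blockList_index μ).mp hx
    have h3 : (k.1 + 1) * n ≤ s * n := Nat.mul_le_mul_right n k.2
    rw [Nat.add_mul] at h3
    have := hμ k
    omega
  have hq : ∀ p : Fin r, p.1 < l.length := fun p => by rw [hlen]; exact p.2
  let f : Fin r → Fin (s * n) := fun p => ⟨l[p.1]'(hq p), hlt _ (List.getElem_mem _)⟩
  -- The list of column indices is strictly increasing with values in `J`, which characterizes the
  -- increasing enumeration.
  have hf : f = J.emb := by
    apply Finset.orderEmbOfFin_unique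
    · intro p
      rw [hJ]
      simpa [iota] using (mem_blockList_index μ).mp (List.getElem_mem (hq p))
    · intro a b hab
      exact List.pairwise_iff_getElem.mp (pairwise_blockList_index μ hμ) _ _ _ _ hab
  rw [List.getElem?_eq_getElem (hq q), ← hf]

/-- The columns of a matrix, extended by zero. -/
def extendCol {N m : ℕ} (A : Matrix (Fin N) (Fin m) R) (x : ℕ) (i : Fin N) : R :=
  if h : x < m then A i ⟨x, h⟩ else 0

/-- Since `μ k ≤ n`, only true columns of `A` are read, never the zero extension. -/
theorem colMatrix_blockList_extendCol {s n r N : ℕ} (A : Matrix (Fin N) (Fin (s * n)) R)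
    (μ : Fin s → ℕ) (hμ : ∀ k, μ k ≤ n) (hr : ∑ k, μ k = r) (J : NSubset (s * n) r)
    (hJ : J.1 = iota n μ) :
    colMatrix (blockList (fun (k : Fin s) j => extendCol A (k.1 * n + j)) μ) r =
      A.submatrix id J.emb := by
  ext i q
  rw [← map_blockList (extendCol A), colMatrix, Matrix.of_apply, List.getD_eq_getElem?_getD,
    List.getElem?_map, getElem?_blockList_index μ hμ hr J hJ]
  simp [extendCol]

theorem WeakComp.le {s n : ℕ} (μ : WeakComp s n) (k : Fin s) : μ.1 k ≤ n :=
  (Finset.single_le_sum (fun _ _ => Nat.zero_le _) (Finset.mem_univ k)).trans_eq μ.2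

end CompoundMinor

open CompoundMinor in
theorem mainTheorem1 {R : Type*} [CommRing R] (s n : ℕ) (hs : 0 < s) (hn : 0 < n)
    (A : Matrix (Fin (s + n - 1)) (Fin (s * n)) R) :
    (CompoundMinor.minorMatrix s n A).det =
      ∏ ν : CompoundMinor.PosComp s (s + n - 1), CompoundMinor.maxMinor A ν.iota := by
  have h := compoundIdentity (s := s) (n := n) (N := s + n - 1) (by omega) R
    (fun k j => extendCol A (k.1 * n + j)) ((colEnum s n).symm.trans (rowEnum s n))
  -- Reindexing by `colEnum` on both sides makes the rows run through `rowEnum`, by the choice of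
  -- order isomorphism.
  rw [← Matrix.det_submatrix_equiv_self (colEnum s n).toEquiv] at h
  convert h using 2
  · ext p q
    simp only [minorMatrix, minor, blockMinors, Matrix.of_apply, Matrix.submatrix_apply,
      OrderIso.trans_apply, RelIso.coe_fn_toEquiv, OrderIso.symm_apply_apply]
    rw [colMatrix_blockList_extendCol A _ (colEnum s n q).le (colEnum s n q).2
      (colEnum s n q).iota rfl, Matrix.submatrix_submatrix]
    rfl
  · rename_i ν _
    rw [maxMinor, blockDet, colMatrix_blockList_extendCol A ν.1 ν.le ν.2.1 ν.iota rfl]
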